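/- Let $A=\mathbb C^m$ and $B=\mathbb C^n$. Let $\{|i\rangle\}$ be an orthonormal basis of $A$, let $\rho_{AB}=\sum_i p_i\,|i\rangle\langle i|\otimes\rho_i$ be a classical-quantum state with respect to this basis, where $(p_i)$ is a probability distribution and the $\rho_i$ are density operators on $B$, and let $\sigma_{AB}$ be any density operator on $A\otimes B$. Put $$\tilde\sigma=\sum_i (|i\rangle\langle i|_A\otimes 1_B)\,\sigma_{AB}\,(|i\rangle\langle i|_A\otimes 1_B),\qquad R=\min\{\operatorname{rank}\rho_{AB},\operatorname{rank}\tilde\sigma\}.$$ Let $\|X\|_1=\operatorname{Tr}\sqrt{X^\dagger X}$ be the trace norm, and let $\|X\|_{\mathrm{LOCC}}=\sup_{\{M_i\}}\sum_i|\operatorname{Tr}(M_iX)|$, where the supremum is over all finite-outcome POVMs $\{M_i\}$ on $A\otimes B$ that can be realized by a (finite-round) protocol of local operations and classical communication between $A$ and $B$. If, for a real number $\epsilon$, $$\tfrac12\|\rho_{AB}-\sigma_{AB}\|_1\ge 1-\epsilon,$$ then $$\tfrac12\|\rho_{AB}-\sigma_{AB}\|_{\mathrm{LOCC}}\ge 1-\sqrt{2R\epsilon}.$$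 In particular, if $\tfrac12\|\rho_{AB}-\sigma_{AB}\|_1=1$, then $\tfrac12\|\rho_{AB}-\sigma_{AB}\|_{\mathrm{LOCC}}=1$. -/

import Mathlib

open scoped Matrix Kronecker ComplexOrder MatrixOrder

noncomputable section

namespace DataHiding

/-- Operators on the bipartite system `ℂ^m ⊗ ℂ^n` (systems `A` and `B`), as matrices. -/
abbrev BiOp (m n : ℕ) : Type := Matrix (Fin m × Fin n) (Fin m × Fin n) ℂ

/-- Density operators: positive semidefinite with unit trace. -/
structure IsState {ι : Type} [Fintype ι] (ρ : Matrix ι ι ℂ) : Prop where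
  posSemidef : ρ.PosSemidef
  trace_eq_one : ρ.trace = 1

/-- The trace norm `‖X‖₁ = Tr √(X† X)`. -/
def traceNorm {ι : Type} [Fintype ι] [DecidableEq ι] (X : Matrix ι ι ℂ) : ℝ :=
  (CFC.sqrt (Xᴴ * X)).trace.re

/-- The rank-one operator `|v⟩⟨v|`. -/
def ketbra {m : ℕ} (v : EuclideanSpace ℂ (Fin m)) : Matrix (Fin m) (Fin m) ℂ :=
  Matrix.of fun i j => v i * star (v j)

/-- `ρ = ∑ᵢ pᵢ |i⟩⟨i| ⊗ ρᵢ` for the orthonormal basis `e` of `A`, with `p` a probability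
distribution and every `ρᵢ` a state of `B`. -/
def IsClassicalQuantum {m n : ℕ} (e : OrthonormalBasis (Fin m) ℂ (EuclideanSpace ℂ (Fin m)))
    (ρ : BiOp m n) : Prop :=
  ∃ (p : Fin m → ℝ) (r : Fin m → Matrix (Fin n) (Fin n) ℂ),
    (∀ i, 0 ≤ p i) ∧ ∑ i, p i = 1 ∧ (∀ i, IsState (r i)) ∧
      ρ = ∑ i, (p i : ℂ) • (ketbra (e i) ⊗ₖ r i)

/-- Dephasing of `A` in the orthonormal basis `e`:
`σ ↦ ∑ᵢ (|i⟩⟨i| ⊗ 1) σ (|i⟩⟨i| ⊗ 1)`. -/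
def dephase {m n : ℕ} (e : OrthonormalBasis (Fin m) ℂ (EuclideanSpace ℂ (Fin m)))
    (σ : BiOp m n) : BiOp m n :=
  ∑ i, (ketbra (e i) ⊗ₖ (1 : Matrix (Fin n) (Fin n) ℂ)) * σ *
    (ketbra (e i) ⊗ₖ (1 : Matrix (Fin n) (Fin n) ℂ))

/-- The POVMs with outcomes `Fin k` on `ℂ^m ⊗ ℂ^n` that are realized by an LOCC protocol with
finitely many rounds. In a round one party applies a quantum instrument to its own system, with
one Kraus operator per outcome (the dimension of that system may change, so local ancillas and
local randomness are included), and announces the outcome `j`; the protocol that follows may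
depend on `j`. A coarser instrument is covered by letting that protocol ignore a part of `j`.
At the end the parties output a label that is determined by the announced outcomes, and distinct
runs may output the same label. The elements are written in the Heisenberg picture. -/
inductive IsLOCC {k : ℕ} : (m n : ℕ) → (Fin k → BiOp m n) → Prop
  /-- No further round: the outcome `c` is output with certainty. -/
  | output (m n : ℕ) (c : Fin k) : IsLOCC m n (fun i => if i = c then 1 else 0)
  /-- The first round is an instrument of `A`, from `ℂ^m` to `ℂ^m'`. -/
  | alice {m n m' s : ℕ} (K : Fin s → Matrix (Fin m') (Fin m) ℂ)
      (hK : ∑ j, (K j)ᴴ * K j = 1) (N : Fin s → Fin k → BiOp m' n)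
      (hN : ∀ j, IsLOCC m' n (N j)) :
      IsLOCC m n (fun i => ∑ j, (K j ⊗ₖ (1 : Matrix (Fin n) (Fin n) ℂ))ᴴ * N j i *
        (K j ⊗ₖ (1 : Matrix (Fin n) (Fin n) ℂ)))
  /-- The first round is an instrument of `B`, from `ℂ^n` to `ℂ^n'`. -/
  | bob {m n n' s : ℕ} (K : Fin s → Matrix (Fin n') (Fin n) ℂ)
      (hK : ∑ j, (K j)ᴴ * K j = 1) (N : Fin s → Fin k → BiOp m n')
      (hN : ∀ j, IsLOCC m n' (N j)) :
      IsLOCC m n (fun i => ∑ j, ((1 : Matrix (Fin m) (Fin m) ℂ) ⊗ₖ K j)ᴴ * N j i *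
        ((1 : Matrix (Fin m) (Fin m) ℂ) ⊗ₖ K j))

/-- The LOCC norm: the supremum of `∑ᵢ |Tr(Mᵢ X)|` over all LOCC POVMs `M`. -/
def loccNorm {m n : ℕ} (X : BiOp m n) : ℝ :=
  sSup {x : ℝ | ∃ (k : ℕ) (M : Fin k → BiOp m n), IsLOCC m n M ∧
    x = ∑ i, ‖(M i * X).trace‖}

/-- An LOCC POVM is a POVM. -/
theorem IsLOCC.isPOVM {k m n : ℕ} {M : Fin k → BiOp m n} (h : IsLOCC m n M) :
    (∀ i, (M i).PosSemidef) ∧ ∑ i, M i = 1 := by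
  induction h with
  | output m n c =>
    refine ⟨fun i => ?_, by simp⟩
    dsimp only
    split_ifs
    · exact Matrix.PosSemidef.one
    · exact Matrix.PosSemidef.zero
  | alice K hK N hN ih =>
    refine ⟨fun i => Matrix.posSemidef_sum _ fun j _ =>
      ((ih j).1 i).conjTranspose_mul_mul_same _, ?_⟩
    have hs : ∀ j, ∑ i, N j i = 1 := fun j => (ih j).2
    rw [Finset.sum_comm]
    simp only [← Matrix.sum_mul, ← Matrix.mul_sum, hs, Matrix.mul_one,
      Matrix.conjTranspose_kronecker, Matrix.conjTranspose_one, ← Matrix.mul_kronecker_mul, mul_one]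
    ext ⟨a, b⟩ ⟨c, d⟩
    have := congrFun (congrFun hK a) c
    simp only [Matrix.sum_apply] at this
    simp [Matrix.sum_apply, this, Matrix.one_apply, Prod.ext_iff, ite_and]
    split_ifs <;> rfl
  | bob K hK N hN ih =>
    refine ⟨fun i => Matrix.posSemidef_sum _ fun j _ =>
      ((ih j).1 i).conjTranspose_mul_mul_same _, ?_⟩
    have hs : ∀ j, ∑ i, N j i = 1 := fun j => (ih j).2
    rw [Finset.sum_comm]
    simp only [← Matrix.sum_mul, ← Matrix.mul_sum, hs, Matrix.mul_one,
      Matrix.conjTranspose_kronecker, Matrix.conjTranspose_one, ← Matrix.mul_kronecker_mul, mul_one]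
    ext ⟨a, b⟩ ⟨c, d⟩
    have := congrFun (congrFun hK b) d
    simp only [Matrix.sum_apply] at this
    simp [Matrix.sum_apply, this, Matrix.one_apply, Prod.ext_iff, ite_and]

/-- The supremum that defines the LOCC norm is over a bounded set. -/
theorem bddAbove_loccNorm {m n : ℕ} (X : BiOp m n) : BddAbove
    {x : ℝ | ∃ (k : ℕ) (M : Fin k → BiOp m n), IsLOCC m n M ∧ x = ∑ i, ‖(M i * X).trace‖} := by
  refine ⟨(Fintype.card (Fin m × Fin n) : ℝ) * ∑ a, ∑ b, ‖X b a‖, ?_⟩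
  rintro _ ⟨k, M, hM, rfl⟩
  obtain ⟨hp, hs⟩ := hM.isPOVM
  have key : ∀ i a b, ‖M i a b‖ ≤ (M i).trace.re := by
    intro i a b
    obtain ⟨B, hB⟩ := CStarAlgebra.nonneg_iff_eq_star_mul_self.1 (hp i).nonneg
    have hd : ∀ c, (M i c c).re = ∑ d, ‖B d c‖ ^ 2 := by
      intro c
      rw [hB, Matrix.star_eq_conjTranspose]
      simp only [Matrix.mul_apply, Matrix.conjTranspose_apply, Complex.re_sum]
      refine Finset.sum_congr rfl fun d _ => ?_
      rw [Complex.star_def, ← Complex.normSq_eq_conj_mul_self, Complex.normSq_eq_norm_sq, Complex.ofReal_re]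
    have hle : ∀ c, (M i c c).re ≤ (M i).trace.re := by
      intro c
      rw [Matrix.trace, Complex.re_sum]
      refine Finset.single_le_sum (f := fun c => (M i c c).re) (fun d _ => ?_) (Finset.mem_univ c)
      rw [hd]; positivity
    have h1 : ‖M i a b‖ ≤ ∑ d, (‖B d a‖ ^ 2 + ‖B d b‖ ^ 2) / 2 := by
      rw [hB, Matrix.star_eq_conjTranspose]
      simp only [Matrix.mul_apply, Matrix.conjTranspose_apply]
      refine (norm_sum_le _ _).trans (Finset.sum_le_sum fun d _ => ?_)
      rw [norm_mul, norm_star]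
      nlinarith [sq_nonneg (‖B d a‖ - ‖B d b‖)]
    rw [← Finset.sum_div, Finset.sum_add_distrib, ← hd, ← hd] at h1
    linarith [hle a, hle b]
  have htr : ∑ i, (M i).trace.re = Fintype.card (Fin m × Fin n) := by
    rw [← Complex.re_sum, ← Matrix.trace_sum, hs, Matrix.trace_one]; simp
  calc ∑ i, ‖(M i * X).trace‖ ≤ ∑ i, (M i).trace.re * ∑ a, ∑ b, ‖X b a‖ := by
        refine Finset.sum_le_sum fun i _ => ?_
        simp only [Matrix.trace, Matrix.diag, Matrix.mul_apply]
        refine (norm_sum_le _ _).trans ?_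
        rw [Finset.mul_sum]
        refine Finset.sum_le_sum fun a _ => (norm_sum_le _ _).trans ?_
        rw [Finset.mul_sum]
        refine Finset.sum_le_sum fun b _ => ?_
        rw [norm_mul]
        exact mul_le_mul_of_nonneg_right (key i a b) (norm_nonneg _)
    _ = _ := by rw [← Finset.sum_mul, htr]

end DataHiding

end

/-!
Write `τ` for the dephased `σ`. Dephasing is self-adjoint and, followed by an arbitrary measurement,
is one-way LOCC (`isLOCC_dephase`): `A` measures in the basis `e` and tells `B` the result. As `ρ`
is classical-quantum it is invariant under dephasing, so the LOCC norm of `ρ - σ` is at least the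
bias of any test on `ρ - τ` (`trace_test_dephase_le_loccNorm`).

By the Powers–Størmer inequality (`exists_projection_powersStormer`) some projective test of
`ρ - τ` has bias at least `Tr (√ρ - √τ)² = 2 - 2 Tr √ρ √τ`. It remains to bound `Tr √ρ √τ`.
Inserting the support projection of `ρ` or of `τ`, whose trace is the rank, Cauchy–Schwarz gives
`(Tr √ρ √τ)² ≤ R Tr ρ τ` (`trace_sqrt_mul_sqrt_le`). Invariance of `ρ` gives `Tr ρ τ = Tr ρ σ`.

The overlap `Tr ρ σ` is at most `2 ε` (`trace_mul_le_of_traceNorm`): an optimal test `Q` for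
`ρ` against `σ` has `Tr (1 - Q) ρ + Tr Q σ ≤ ε`, and the quadratic form `q(Z) = Tr (Z σ Z ρ)` on
Hermitian `Z` satisfies `q(1) ≤ 2 q(Q) + 2 q(1 - Q)`, where `q(Q) ≤ Tr Q σ` and
`q(1 - Q) ≤ Tr (1 - Q) ρ` because states are at most `1`.
-/

namespace DataHiding

/-! ### Spectral projections and trace inequalities -/

section Spectral

variable {ι : Type} [Fintype ι] [DecidableEq ι]

lemma trace_mul_nonneg {A B : Matrix ι ι ℂ} (hA : A.PosSemidef) (hB : B.PosSemidef) :
    0 ≤ (A * B).trace := by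
  obtain ⟨C, rfl⟩ := CStarAlgebra.nonneg_iff_eq_star_mul_self.1 hA.nonneg
  rw [mul_assoc, Matrix.trace_mul_comm, Matrix.star_eq_conjTranspose]
  exact (hB.mul_mul_conjTranspose_same C).trace_nonneg

lemma trace_mul_re_nonneg {A B : Matrix ι ι ℂ} (hA : A.PosSemidef) (hB : B.PosSemidef) :
    0 ≤ (A * B).trace.re :=
  (Complex.nonneg_iff.1 (trace_mul_nonneg hA hB)).1

omit [DecidableEq ι] in
lemma posSemidef_hermitian_conj {A Z : Matrix ι ι ℂ} (hA : A.PosSemidef) (hZ : Z.IsHermitian) :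
    (Z * A * Z).PosSemidef := by
  have := hA.mul_mul_conjTranspose_same Z
  rwa [hZ.eq] at this

lemma isHermitian_two_mul_sub_one {Q : Matrix ι ι ℂ} (hQ : Q.IsHermitian) :
    (2 * Q - 1).IsHermitian := by
  rw [two_mul]
  exact (hQ.add hQ).sub Matrix.isHermitian_one

/-- The spectral projection `Q` of a Hermitian matrix `X` onto its nonnegative eigenvalues. It
splits `X` into the positive part `Q X` and the negative part `-(1 - Q) X`. -/
lemma exists_nonneg_spectral_projection {X : Matrix ι ι ℂ} (hX : X.IsHermitian) :
    ∃ Q : Matrix ι ι ℂ, Q.IsHermitian ∧ Q * Q = Q ∧ X * Q = Q * X ∧ (Q * X).PosSemidef ∧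
      (-((1 - Q) * X)).PosSemidef ∧ (2 * Q - 1) * X = CFC.abs X := by
  have hc (f : ℝ → ℝ) : ContinuousOn f (spectrum ℝ X) :=
    Set.Finite.continuousOn (Matrix.finite_real_spectrum) f
  have hX' : IsSelfAdjoint X := hX
  have hid : cfc (fun x : ℝ => x) X = X := cfc_id' ℝ X
  let g : ℝ → ℝ := fun x => if 0 ≤ x then 1 else 0
  have h1 : cfc g X * X = cfc (fun x => g x * x) X := by
    rw [cfc_mul g (fun x => x) X (hc _) (hc _), hid]
  have h2 : CFC.abs X = cfc (fun x : ℝ => |x|) X := by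
    rw [CFC.abs_eq_cfc_norm X hX']; rfl
  refine ⟨cfc g X, cfc_predicate g X, ?_, ?_, ?_, ?_, ?_⟩
  · rw [← cfc_mul g g X (hc _) (hc _)]
    congr 1; ext x; simp only [g]; split_ifs <;> simp
  · exact (cfc_commute_cfc (fun x : ℝ => x) g X).eq |> fun h => by rwa [hid] at h
  · rw [h1]
    refine Matrix.LE.le.posSemidef (cfc_nonneg fun x _ => ?_)
    simp only [g]; split_ifs <;> simp [*]
  · have : -((1 - cfc g X) * X) = cfc (fun x => g x * x - x) X := by
      rw [cfc_sub _ _ X (hc _) (hc _), hid, ← h1]; noncomm_ring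
    rw [this]
    refine Matrix.LE.le.posSemidef (cfc_nonneg fun x _ => ?_)
    simp only [g]; split_ifs with h
    · simp
    · simpa using (not_le.1 h).le
  · have : (2 * cfc g X - 1) * X = cfc (fun x => (g x * x + g x * x) - x) X := by
      rw [cfc_sub (fun x => g x * x + g x * x) _ X (hc _) (hc _),
        cfc_add X (fun x => g x * x) (fun x => g x * x) (hc _) (hc _), hid, ← h1]; noncomm_ring
    rw [this, h2]
    congr 1; ext x; simp only [g]; split_ifs with h
    · simp [abs_of_nonneg h]
    · simp [abs_of_neg (not_le.1 h)]

/-- Trace distance as the bias of an optimal projective test. -/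
lemma exists_projection_traceNorm {X : Matrix ι ι ℂ} (hX : X.IsHermitian) :
    ∃ Q : Matrix ι ι ℂ, Q.IsHermitian ∧ Q * Q = Q ∧ traceNorm X = ((2 * Q - 1) * X).trace.re := by
  obtain ⟨Q, h1, h2, -, -, -, h3⟩ := exists_nonneg_spectral_projection hX
  exact ⟨Q, h1, h2, by rw [h3]; rfl⟩

/-- The **Powers–Størmer inequality** in variational form. -/
lemma exists_projection_powersStormer {A B : Matrix ι ι ℂ} (hA : A.PosSemidef)
    (hB : B.PosSemidef) :
    ∃ Q : Matrix ι ι ℂ, Q.IsHermitian ∧ Q * Q = Q ∧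
      ((A - B) * (A - B)).trace.re ≤ ((2 * Q - 1) * (A * A - B * B)).trace.re := by
  obtain ⟨Q, h1, h2, hc, hp, hn, -⟩ :=
    exists_nonneg_spectral_projection (hA.isHermitian.sub hB.isHermitian)
  refine ⟨Q, h1, h2, ?_⟩
  have e1 := trace_mul_re_nonneg hp hB
  have e2 := trace_mul_re_nonneg hn hA
  set S := A - B with hS
  have k1 : A * A - B * B = B * S + S * B + S * S := by rw [hS]; noncomm_ring
  have k2 : (Q * (B * S)).trace = (Q * S * B).trace := by
    rw [← mul_assoc, Matrix.trace_mul_comm, ← mul_assoc, hc]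
  have k3 : (B * S).trace = (S * B).trace := Matrix.trace_mul_comm _ _
  have k4 : A = B + S := by rw [hS]; abel
  have k5 : ((2 * Q - 1) * (A * A - B * B)).trace
      = (S * S).trace + 2 * (Q * S * B).trace + 2 * (-((1 - Q) * S) * A).trace := by
    rw [k1, k4]
    have : (2 * Q - 1) * (B * S + S * B + S * S) = Q * (B * S) + Q * (B * S)
        + (Q * S * B + Q * S * B) + (Q * S * S + Q * S * S) - B * S - S * B - S * S := by
      noncomm_ring
    have h' : -((1 - Q) * S) * (B + S) = Q * S * B + Q * S * S - S * B - S * S := by noncomm_ring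
    rw [this, h']
    simp only [Matrix.trace_add, Matrix.trace_sub, k2, k3]
    ring
  rw [k5]
  simp only [Complex.add_re, Complex.mul_re, Complex.re_ofNat, Complex.im_ofNat]
  linarith

lemma IsState.one_sub_posSemidef {ρ : Matrix ι ι ℂ} (hρ : IsState ρ) : (1 - ρ).PosSemidef := by
  have hX' : IsSelfAdjoint ρ := hρ.posSemidef.isHermitian
  have hc (f : ℝ → ℝ) : ContinuousOn f (spectrum ℝ ρ) :=
    Set.Finite.continuousOn (Matrix.finite_real_spectrum) f
  have : 1 - ρ = cfc (fun x : ℝ => 1 - x) ρ := by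
    rw [cfc_sub _ _ ρ (hc _) (hc _), cfc_id' ℝ ρ, cfc_const_one ℝ ρ]
  rw [this]
  refine Matrix.LE.le.posSemidef (cfc_nonneg fun x hx => ?_)
  rw [hρ.posSemidef.isHermitian.spectrum_real_eq_range_eigenvalues] at hx
  obtain ⟨i, rfl⟩ := hx
  have h := hρ.posSemidef.isHermitian.trace_eq_sum_eigenvalues
  rw [hρ.trace_eq_one, ← RCLike.ofReal_sum] at h
  have h' : ∑ i, hρ.posSemidef.isHermitian.eigenvalues i = 1 := Complex.ofReal_eq_one.1 h.symm
  have := Finset.single_le_sum (f := hρ.posSemidef.isHermitian.eigenvalues)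
    (fun j _ => hρ.posSemidef.eigenvalues_nonneg j) (Finset.mem_univ i)
  linarith

/-- The support projection `P` of a positive semidefinite matrix. -/
lemma exists_support_projection {A : Matrix ι ι ℂ} (hA : A.PosSemidef) :
    ∃ P : Matrix ι ι ℂ, P.IsHermitian ∧ P * P = P ∧ P * CFC.sqrt A = CFC.sqrt A ∧
      P.trace = A.rank := by
  have hX' : IsSelfAdjoint A := hA.isHermitian
  have hc (f : ℝ → ℝ) : ContinuousOn f (spectrum ℝ A) :=
    Set.Finite.continuousOn (Matrix.finite_real_spectrum) f
  let g : ℝ → ℝ := fun x => if x = 0 then 0 else 1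
  refine ⟨cfc g A, cfc_predicate g A, ?_, ?_, ?_⟩
  · rw [← cfc_mul g g A (hc _) (hc _)]
    congr 1; ext x; simp only [g]; split_ifs <;> simp
  · rw [CFC.sqrt_eq_real_sqrt A hA.nonneg, cfcₙ_eq_cfc (f := Real.sqrt)
        (hf := Real.continuous_sqrt.continuousOn),
      ← cfc_mul g _ A (hc _) (hc _)]
    congr 1; ext x; simp only [g]; split_ifs <;> simp [*]
  · rw [hA.isHermitian.cfc_eq, Matrix.IsHermitian.cfc, Unitary.conjStarAlgAut_apply,
      Matrix.trace_mul_cycle, Unitary.coe_star_mul_self, one_mul,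
      Matrix.trace_diagonal, hA.isHermitian.rank_eq_card_non_zero_eigs]
    simp only [Function.comp_apply, g, Fintype.card_subtype, Finset.card_filter, Nat.cast_sum]
    exact Finset.sum_congr rfl fun i _ => by split_ifs <;> simp_all

/-- Cauchy–Schwarz for the Hilbert–Schmidt inner product, applied to the support projection
of `A` and to `√A √B`. -/
lemma trace_sqrt_mul_sqrt_le {A B : Matrix ι ι ℂ} (hA : A.PosSemidef) (hB : B.PosSemidef) :
    (CFC.sqrt A * CFC.sqrt B).trace.re ≤ √(A.rank * (A * B).trace.re) := by
  obtain ⟨P, hP, hPP, hPA, htr⟩ := exists_support_projection hA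
  have hsA : (CFC.sqrt A)ᴴ = CFC.sqrt A := (CFC.sqrt_nonneg A).isSelfAdjoint
  have hsB : (CFC.sqrt B)ᴴ = CFC.sqrt B := (CFC.sqrt_nonneg B).isSelfAdjoint
  have qA : CFC.sqrt A * CFC.sqrt A = A := CFC.sqrt_mul_sqrt_self A hA.nonneg
  have qB : CFC.sqrt B * CFC.sqrt B = B := CFC.sqrt_mul_sqrt_self B hB.nonneg
  set a := CFC.sqrt A
  set b := CFC.sqrt B
  have hba : b * a * P = b * a := by
    have := congrArg Matrix.conjTranspose hPA
    rw [Matrix.conjTranspose_mul, hsA, hP.eq] at this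
    rw [mul_assoc, this]
  have quad (t : ℝ) : 0 ≤ (A.rank : ℝ) * (t * t) + (-2 * (a * b).trace.re) * t
      + (A * B).trace.re := by
    have h0 : 0 ≤ ((((t : ℂ) • P - a * b)ᴴ * ((t : ℂ) • P - a * b)).trace).re :=
      (Complex.nonneg_iff.1 (Matrix.posSemidef_conjTranspose_mul_self _).trace_nonneg).1
    have h1 : (((t : ℂ) • P - a * b)ᴴ * ((t : ℂ) • P - a * b)).trace =
        A.rank * (t * t) - 2 * (a * b).trace * t + (A * B).trace := by
      have e1 : (b * a * (a * b)).trace = (A * B).trace := by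
        rw [Matrix.trace_mul_comm, mul_assoc, ← mul_assoc b, qB, Matrix.trace_mul_comm, mul_assoc,
          qA, Matrix.trace_mul_comm]
      have e2 : P * (a * b) = a * b := by rw [← mul_assoc, hPA]
      rw [Matrix.conjTranspose_sub, Matrix.conjTranspose_smul, Matrix.conjTranspose_mul, hsA, hsB,
        hP.eq, sub_mul, mul_sub, mul_sub]
      simp only [Matrix.smul_mul, Matrix.mul_smul, hPP, e2, hba, Matrix.trace_sub,
        Matrix.trace_smul, e1, htr, Matrix.trace_mul_comm b a, smul_eq_mul]
      simp
      ring
    rw [h1] at h0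
    simp at h0
    linarith
  have hd := discrim_le_zero quad
  rw [discrim] at hd
  exact Real.le_sqrt_of_sq_le (by linarith)

/-- Two states that are almost perfectly distinguishable are almost orthogonal. -/
lemma trace_mul_le_of_traceNorm {ρ σ : Matrix ι ι ℂ} (hρ : IsState ρ) (hσ : IsState σ) {ε : ℝ}
    (h : 1 - ε ≤ 1 / 2 * traceNorm (ρ - σ)) : (ρ * σ).trace.re ≤ 2 * ε := by
  obtain ⟨Q, hQ, hQQ, hn⟩ :=
    exists_projection_traceNorm (hρ.posSemidef.isHermitian.sub hσ.posSemidef.isHermitian)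
  have hQ' : (1 - Q).IsHermitian := Matrix.isHermitian_one.sub hQ
  have hQQ' : (1 - Q) * (1 - Q) = 1 - Q := by
    rw [sub_mul, one_mul, mul_sub, mul_one, hQQ, sub_self, sub_zero]
  have pQσ := posSemidef_hermitian_conj hσ.posSemidef hQ
  have pQρ := posSemidef_hermitian_conj hρ.posSemidef hQ'
  have pd := posSemidef_hermitian_conj hσ.posSemidef (isHermitian_two_mul_sub_one hQ)
  have i1 := trace_mul_re_nonneg pQσ hρ.one_sub_posSemidef
  have i2 := trace_mul_re_nonneg pQρ hσ.one_sub_posSemidef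
  have i3 := trace_mul_re_nonneg pd hρ.posSemidef
  have t1 : (Q * σ * Q).trace = (Q * σ).trace := by
    rw [Matrix.trace_mul_comm, ← mul_assoc, hQQ]
  have t2 : ((1 - Q) * ρ * (1 - Q)).trace = ((1 - Q) * ρ).trace := by
    rw [Matrix.trace_mul_comm, ← mul_assoc, hQQ']
  have t3 : ((1 - Q) * ρ * (1 - Q) * σ).trace = ((1 - Q) * σ * (1 - Q) * ρ).trace := by
    rw [mul_assoc, Matrix.trace_mul_comm, ← mul_assoc]
  -- parallelogram identity for the quadratic form `Z ↦ Tr (Z σ Z ρ)` at `Q` and `1 - Q`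
  have t4 : ((2 * Q - 1) * σ * (2 * Q - 1) * ρ).trace + (σ * ρ).trace
      = 2 * (Q * σ * Q * ρ).trace + 2 * ((1 - Q) * σ * (1 - Q) * ρ).trace := by
    have : (2 * Q - 1) * σ * (2 * Q - 1) * ρ + σ * ρ = (Q * σ * Q * ρ + Q * σ * Q * ρ)
        + ((1 - Q) * σ * (1 - Q) * ρ + (1 - Q) * σ * (1 - Q) * ρ) := by noncomm_ring
    rw [← Matrix.trace_add, this]
    simp only [Matrix.trace_add]; ring
  rw [mul_sub, mul_one, Matrix.trace_sub, t1, Complex.sub_re] at i1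
  rw [mul_sub, mul_one, Matrix.trace_sub, t2, t3, Complex.sub_re] at i2
  have t5 : ((2 * Q - 1) * (ρ - σ)).trace
      = 2 - 2 * ((1 - Q) * ρ).trace - 2 * (Q * σ).trace := by
    have : (2 * Q - 1) * (ρ - σ) = ρ + σ - ((1 - Q) * ρ + (1 - Q) * ρ) - (Q * σ + Q * σ) := by
      noncomm_ring
    rw [this]
    simp only [Matrix.trace_add, Matrix.trace_sub, hρ.trace_eq_one, hσ.trace_eq_one]; ring
  rw [hn, t5] at h
  have t6 := congrArg Complex.re t4
  rw [Matrix.trace_mul_comm ρ σ]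
  simp at t6 h
  linarith

end Spectral

/-! ### Dephasing and classical-quantum states -/

variable {m n : ℕ} (e : OrthonormalBasis (Fin m) ℂ (EuclideanSpace ℂ (Fin m)))

/-- Orthonormality of `e` in coordinates. -/
lemma sum_star_basis_mul_basis (i j : Fin m) :
    ∑ a, star (e i a) * e j a = if i = j then 1 else 0 := by
  rw [← orthonormal_iff_ite.1 e.orthonormal i j, PiLp.inner_apply]
  exact Finset.sum_congr rfl fun a _ => by simp [mul_comm]

lemma ketbra_mul_ketbra (i j : Fin m) :
    ketbra (e i) * ketbra (e j) = if i = j then ketbra (e i) else 0 := by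
  ext a b
  have h : (ketbra (e i) * ketbra (e j)) a b
      = e i a * (∑ c, star (e i c) * e j c) * star (e j b) := by
    simp only [Matrix.mul_apply, ketbra, Matrix.of_apply, Finset.mul_sum, Finset.sum_mul]
    exact Finset.sum_congr rfl fun c _ => by ring
  rw [h, sum_star_basis_mul_basis]
  split_ifs with hij
  · subst hij; simp [ketbra]
  · simp

/-- Completeness of `e`. -/
lemma sum_ketbra : ∑ i, ketbra (e i) = 1 := by
  ext a b
  have h := congrArg (fun v => v a) (e.sum_repr' (EuclideanSpace.single b 1))
  simp [EuclideanSpace.inner_single_right] at h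
  simp only [Matrix.sum_apply, ketbra, Matrix.of_apply, Matrix.one_apply]
  simpa [mul_comm, Pi.single_apply] using h

lemma isHermitian_ketbra_kronecker_one (v : EuclideanSpace ℂ (Fin m)) :
    (ketbra v ⊗ₖ (1 : Matrix (Fin n) (Fin n) ℂ)).IsHermitian := by
  rw [Matrix.IsHermitian, Matrix.conjTranspose_kronecker, Matrix.conjTranspose_one]
  congr 1
  ext a b
  simp [ketbra, mul_comm]

lemma dephase_posSemidef {σ : BiOp m n} (hσ : σ.PosSemidef) : (dephase e σ).PosSemidef :=
  Matrix.posSemidef_sum _ fun i _ =>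
    posSemidef_hermitian_conj hσ (isHermitian_ketbra_kronecker_one (e i))

lemma dephase_sub (ρ σ : BiOp m n) : dephase e (ρ - σ) = dephase e ρ - dephase e σ := by
  simp [dephase, mul_sub, sub_mul]

lemma dephase_one : dephase e (1 : BiOp m n) = 1 := by
  simp only [dephase, mul_one, ← Matrix.mul_kronecker_mul, ketbra_mul_ketbra, if_true]
  rw [← Matrix.one_kronecker_one, ← sum_ketbra e]
  ext ⟨a, b⟩ ⟨c, d⟩
  simp [Matrix.sum_apply, Finset.sum_mul]

/-- Dephasing is self-adjoint for the Hilbert–Schmidt inner product, so a dephased test of `X`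
is a test of the dephased `X`. -/
lemma trace_dephase_mul (M X : BiOp m n) :
    (dephase e M * X).trace = (M * dephase e X).trace := by
  simp only [dephase, Finset.sum_mul, Finset.mul_sum, Matrix.trace_sum]
  refine Finset.sum_congr rfl fun i _ => ?_
  rw [mul_assoc, mul_assoc, Matrix.trace_mul_comm]
  simp only [mul_assoc]

lemma trace_dephase (X : BiOp m n) : (dephase e X).trace = X.trace := by
  have := trace_dephase_mul e 1 X
  rw [dephase_one, one_mul, one_mul] at this
  exact this.symm

lemma IsState.dephase {σ : BiOp m n} (hσ : IsState σ) : IsState (dephase e σ) :=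
  ⟨dephase_posSemidef e hσ.posSemidef, by rw [trace_dephase, hσ.trace_eq_one]⟩

variable {e}

lemma IsClassicalQuantum.dephase_eq {ρ : BiOp m n} (hρ : IsClassicalQuantum e ρ) :
    dephase e ρ = ρ := by
  obtain ⟨p, r, -, -, -, rfl⟩ := hρ
  simp only [dephase, Finset.mul_sum, Finset.sum_mul, Matrix.mul_smul, Matrix.smul_mul,
    ← Matrix.mul_kronecker_mul, ketbra_mul_ketbra, one_mul, mul_one]
  refine Finset.sum_congr rfl fun i _ => ?_
  rw [Finset.sum_eq_single i (fun j _ hj => by simp [hj.symm]) (by simp)]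
  simp [ketbra_mul_ketbra]

lemma IsClassicalQuantum.isState {ρ : BiOp m n} (hρ : IsClassicalQuantum e ρ) : IsState ρ := by
  obtain ⟨p, r, hp, hs, hr, rfl⟩ := hρ
  have hk (i) : (ketbra (e i)).PosSemidef := by
    simpa [Matrix.vecMulVec, ketbra, Pi.star_def] using
      Matrix.posSemidef_vecMulVec_self_star (fun a => e i a)
  have ht (i) : (ketbra (e i)).trace = 1 := by
    have := sum_star_basis_mul_basis e i i
    simpa [Matrix.trace, ketbra, mul_comm] using this
  refine ⟨Matrix.posSemidef_sum _ fun i _ =>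
    ((hk i).kronecker (hr i).posSemidef).smul (by exact_mod_cast hp i), ?_⟩
  simp only [Matrix.trace_sum, Matrix.trace_smul, Matrix.trace_kronecker, ht,
    (hr _).trace_eq_one, mul_one, smul_eq_mul]
  exact_mod_cast hs

variable (e)

/-! ### LOCC measurements and the LOCC norm -/

/-- Dephasing turns every POVM into one-way LOCC: `A` measures in the basis `e` and announces the
result `i`, and `B` measures the POVM compressed to the block `⟨i| · |i⟩`, by the instrument with
the square roots of its elements as Kraus operators. -/
lemma isLOCC_dephase {k : ℕ} {M : Fin k → BiOp m n} (hM : ∀ l, (M l).PosSemidef)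
    (hs : ∑ l, M l = 1) : IsLOCC m n (fun l => dephase e (M l)) := by
  let K : Fin m → Matrix (Fin 1) (Fin m) ℂ := fun i => Matrix.of fun _ a => star (e i a)
  let V : Fin m → Matrix (Fin 1 × Fin n) (Fin m × Fin n) ℂ :=
    fun i => K i ⊗ₖ (1 : Matrix (Fin n) (Fin n) ℂ)
  have hKK (i) : (K i)ᴴ * K i = ketbra (e i) := by
    ext a b
    simp [Matrix.mul_apply, K, ketbra]
  have hKK' (i) : K i * (K i)ᴴ = 1 := by
    ext a b
    have := sum_star_basis_mul_basis e i i
    obtain rfl := Subsingleton.elim a b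
    simpa [Matrix.mul_apply, K] using this
  have hVV (i) : (V i)ᴴ * V i = ketbra (e i) ⊗ₖ (1 : Matrix (Fin n) (Fin n) ℂ) := by
    simp only [V, Matrix.conjTranspose_kronecker, ← Matrix.mul_kronecker_mul, hKK,
      Matrix.conjTranspose_one, mul_one]
  have hVV' (i) : V i * (V i)ᴴ = 1 := by
    simp only [V, Matrix.conjTranspose_kronecker, ← Matrix.mul_kronecker_mul, hKK',
      Matrix.conjTranspose_one, mul_one, Matrix.one_kronecker_one]
  let R : Fin m → Fin k → Matrix (Fin n) (Fin n) ℂ :=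
    fun i l => (V i * M l * (V i)ᴴ).submatrix (Prod.mk 0) (Prod.mk 0)
  have hR (i l) : (1 : Matrix (Fin 1) (Fin 1) ℂ) ⊗ₖ R i l = V i * M l * (V i)ᴴ := by
    ext ⟨a, b⟩ ⟨c, d⟩
    obtain rfl := Subsingleton.elim a 0
    obtain rfl := Subsingleton.elim c 0
    simp only [Matrix.kroneckerMap_apply, Matrix.one_apply_eq, one_mul, R, Matrix.submatrix_apply]
  have hRp (i l) : (R i l).PosSemidef :=
    ((hM l).mul_mul_conjTranspose_same (V i)).submatrix _
  have hsq (i l) : (CFC.sqrt (R i l))ᴴ * CFC.sqrt (R i l) = R i l := by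
    rw [← Matrix.star_eq_conjTranspose, (CFC.sqrt_nonneg (R i l)).isSelfAdjoint.star_eq,
      CFC.sqrt_mul_sqrt_self _ (hRp i l).nonneg]
  have hRs (i) : ∑ l, (CFC.sqrt (R i l))ᴴ * CFC.sqrt (R i l) = 1 := by
    simp only [hsq]
    have h : ∑ l, V i * M l * (V i)ᴴ = 1 := by
      rw [← Matrix.sum_mul, ← Matrix.mul_sum, hs, Matrix.mul_one, hVV']
    ext b d
    have := congrFun (congrFun h (0, b)) (0, d)
    simpa [Matrix.sum_apply, R, Matrix.one_apply] using this
  have hB (i) : IsLOCC 1 n (fun l => V i * M l * (V i)ᴴ) := by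
    convert IsLOCC.bob (fun l => CFC.sqrt (R i l)) (hRs i) _
      (fun c => IsLOCC.output (k := k) 1 n c) using 2 with l
    rw [Finset.sum_eq_single l (fun c _ hc => by simp [hc.symm]) (by simp), if_pos rfl,
      Matrix.mul_one, ← hR, Matrix.conjTranspose_kronecker, ← Matrix.mul_kronecker_mul, hsq,
      Matrix.conjTranspose_one, mul_one]
  convert IsLOCC.alice K (by simp only [hKK, sum_ketbra]) _ hB using 2 with l
  refine Finset.sum_congr rfl fun i _ => ?_
  change _ = (V i)ᴴ * (V i * M l * (V i)ᴴ) * V i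
  rw [← hVV]
  simp only [Matrix.mul_assoc]

/-- The bias of any projective test `{Q, 1 - Q}` on the dephased operator is attained by LOCC. -/
lemma trace_test_dephase_le_loccNorm {Q : BiOp m n} (hQ : Q.IsHermitian) (hQQ : Q * Q = Q)
    (X : BiOp m n) : ((2 * Q - 1) * dephase e X).trace.re ≤ loccNorm X := by
  have hp : ∀ l, ((![Q, 1 - Q] : Fin 2 → BiOp m n) l).PosSemidef := by
    have h (P : BiOp m n) (hP : P.IsHermitian) (hPP : P * P = P) : P.PosSemidef := by
      have := Matrix.posSemidef_conjTranspose_mul_self P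
      rwa [hP.eq, hPP] at this
    refine Fin.forall_fin_two.2 ⟨h _ hQ hQQ, h _ (Matrix.isHermitian_one.sub hQ) ?_⟩
    simp [sub_mul, mul_sub, hQQ]
  have hL := isLOCC_dephase e hp (by simp)
  refine le_trans ?_ (le_csSup (bddAbove_loccNorm X) ⟨2, _, hL, rfl⟩)
  simp only [Fin.sum_univ_two, Matrix.cons_val_zero, Matrix.cons_val_one, trace_dephase_mul]
  have h : (2 * Q - 1) * dephase e X = Q * dephase e X - (1 - Q) * dephase e X := by
    noncomm_ring
  rw [h, Matrix.trace_sub, Complex.sub_re]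
  have h1 := Complex.abs_re_le_norm (Q * dephase e X).trace
  have h2 := Complex.abs_re_le_norm ((1 - Q) * dephase e X).trace
  linarith [le_abs_self (Q * dephase e X).trace.re, neg_abs_le ((1 - Q) * dephase e X).trace.re]

lemma loccNorm_sub_le_two {ρ σ : BiOp m n} (hρ : IsState ρ) (hσ : IsState σ) :
    loccNorm (ρ - σ) ≤ 2 := by
  refine Real.sSup_le ?_ zero_le_two
  rintro _ ⟨k, M, hM, rfl⟩
  obtain ⟨hp, hs⟩ := hM.isPOVM
  have hsum {τ : BiOp m n} (hτ : IsState τ) : ∑ i, ‖(M i * τ).trace‖ = 1 := by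
    have h (i) : (‖(M i * τ).trace‖ : ℂ) = (M i * τ).trace :=
      (Complex.eq_coe_norm_of_nonneg (trace_mul_nonneg (hp i) hτ.posSemidef)).symm
    have : ((∑ i, ‖(M i * τ).trace‖ : ℝ) : ℂ) = 1 := by
      rw [Complex.ofReal_sum]
      simp only [h]
      rw [← Matrix.trace_sum, ← Finset.sum_mul, hs, one_mul, hτ.trace_eq_one]
    exact_mod_cast this
  calc ∑ i, ‖(M i * (ρ - σ)).trace‖ ≤ ∑ i, (‖(M i * ρ).trace‖ + ‖(M i * σ).trace‖) := by
        refine Finset.sum_le_sum fun i _ => ?_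
        rw [mul_sub, Matrix.trace_sub]
        exact norm_sub_le _ _
    _ = 2 := by rw [Finset.sum_add_distrib, hsum hρ, hsum hσ]; norm_num

variable {e}

lemma one_sub_sqrt_le_loccNorm {ρ σ : BiOp m n} (hρ : IsClassicalQuantum e ρ) (hσ : IsState σ)
    {ε : ℝ} (h : 1 - ε ≤ 1 / 2 * traceNorm (ρ - σ)) :
    1 - √(2 * ((min ρ.rank (dephase e σ).rank : ℕ) : ℝ) * ε) ≤ 1 / 2 * loccNorm (ρ - σ) := by
  have hρs := hρ.isState
  have hτ := hσ.dephase e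
  -- `ρ` is invariant under dephasing, so its overlap with `σ` survives the dephasing of `σ`
  have hov : (ρ * dephase e σ).trace.re ≤ 2 * ε := by
    rw [← trace_dephase_mul, hρ.dephase_eq]
    exact trace_mul_le_of_traceNorm hρs hσ h
  have hF : (CFC.sqrt ρ * CFC.sqrt (dephase e σ)).trace.re ≤
      √(2 * ((min ρ.rank (dephase e σ).rank : ℕ) : ℝ) * ε) := by
    rcases min_choice ρ.rank (dephase e σ).rank with hr | hr <;> rw [hr]
    · refine (trace_sqrt_mul_sqrt_le hρs.posSemidef hτ.posSemidef).trans (Real.sqrt_le_sqrt ?_)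
      nlinarith [Nat.cast_nonneg (α := ℝ) ρ.rank]
    · rw [Matrix.trace_mul_comm]
      rw [Matrix.trace_mul_comm] at hov
      refine (trace_sqrt_mul_sqrt_le hτ.posSemidef hρs.posSemidef).trans (Real.sqrt_le_sqrt ?_)
      nlinarith [Nat.cast_nonneg (α := ℝ) (dephase e σ).rank]
  have qρ := CFC.sqrt_mul_sqrt_self ρ hρs.posSemidef.nonneg
  have qτ := CFC.sqrt_mul_sqrt_self (dephase e σ) hτ.posSemidef.nonneg
  obtain ⟨Q, hQ, hQQ, hps⟩ := exists_projection_powersStormer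
    (Matrix.LE.le.posSemidef (CFC.sqrt_nonneg ρ))
    (Matrix.LE.le.posSemidef (CFC.sqrt_nonneg (dephase e σ)))
  have hL := trace_test_dephase_le_loccNorm e hQ hQQ (ρ - σ)
  rw [dephase_sub, hρ.dephase_eq] at hL
  rw [qρ, qτ, sub_mul, mul_sub, mul_sub, qρ, qτ, Matrix.trace_sub, Matrix.trace_sub,
    Matrix.trace_sub, hρs.trace_eq_one, hτ.trace_eq_one,
    Matrix.trace_mul_comm (CFC.sqrt (dephase e σ))] at hps
  simp only [Complex.sub_re, Complex.one_re] at hps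
  linarith

end DataHiding

theorem mainTheorem4 {m n : ℕ}
    (e : OrthonormalBasis (Fin m) ℂ (EuclideanSpace ℂ (Fin m)))
    (ρ σ : DataHiding.BiOp m n)
    (hρ : DataHiding.IsClassicalQuantum e ρ) (hσ : DataHiding.IsState σ) :
    (∀ ε : ℝ, 1 - ε ≤ 1 / 2 * DataHiding.traceNorm (ρ - σ) →
      1 - Real.sqrt (2 * ((min ρ.rank (DataHiding.dephase e σ).rank : ℕ) : ℝ) * ε) ≤
        1 / 2 * DataHiding.loccNorm (ρ - σ)) ∧
    (1 / 2 * DataHiding.traceNorm (ρ - σ) = 1 →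
      1 / 2 * DataHiding.loccNorm (ρ - σ) = 1) := by
  refine ⟨fun ε h => DataHiding.one_sub_sqrt_le_loccNorm hρ hσ h, fun h => le_antisymm ?_ ?_⟩
  · linarith [DataHiding.loccNorm_sub_le_two hρ.isState hσ]
  · have := DataHiding.one_sub_sqrt_le_loccNorm hρ hσ (ε := 0) (by linarith)
    simpa using this
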